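/- For a group $G$, let $\Gamma(G)$ be the graph whose vertices are the elements of $G$, two distinct vertices $a, b$ being joined by an edge if and only if $\langle a, b\rangle = G$, and let $\Gamma^*(G)$ be the subgraph of $\Gamma(G)$ induced by the vertices of $\Gamma(G)$ that are not isolated. Let $F$ be a free group of rank $2$. Then the graph $\Gamma^*(F)$ is connected. -/

import Mathlib

/-- The generating graph of a group `G`: two distinct elements are adjacent if and only if
they generate `G`. -/
def generatingGraph (G : Type*) [Group G] : SimpleGraph G where
  Adj a b := a ≠ b ∧ Subgroup.closure {a, b} = ⊤
  symm := ⟨fun a b h => ⟨h.1.symm, by rw [Set.pair_comm]; exact h.2⟩⟩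
  loopless := ⟨fun _ h => h.1 rfl⟩

/-- The subgraph of the generating graph induced by its non-isolated vertices
(`SimpleGraph.support` is the set of vertices that have a neighbour). -/
def reducedGeneratingGraph (G : Type*) [Group G] :
    SimpleGraph (generatingGraph G).support :=
  (generatingGraph G).induce (generatingGraph G).support

/-!
# The generating graph of a free group of rank two

Every generating pair of a free group of rank two is brought to a pair containing a basis element
or its inverse by Nielsen moves and simultaneous conjugations. Each of these stays within one
connected component of the generating graph.
-/

/-! Generating pairs sharing an entry lie in one component, so Nielsen moves never leave it. Neither
does conjugation: conjugating an entry by a member of its pair stays in the component, and the two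
members generate the group.

Take a pair of least total word length meeting a given component. Minimality bounds the cancellation
between its letters (`overlap_add_overlap_lt`, `overlap_add_overlap_inv_lt`); conjugation disposes
of the tie in which an entry is absorbed half from each side. Hence a nonempty reduced word in the
pair is at least as long as some letter (`TreeLength.exists_len_letterVal_le`). A basis element is
such a word and has length one, so some letter has length one and is itself a basis element or its
inverse; all of these lie in one component. -/

namespace GeneratingGraph

/-- A length function on a group together with the Gromov product (`overlap`) of the associated
left-invariant metric, such that the metric is integral, geodesic and `0`-hyperbolic, and
such that the group has no elements of order two. -/
structure TreeLength (G : Type*) [Group G] where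
  /-- The length of an element. -/
  len : G → ℕ
  /-- The length of the common initial segment of two elements. -/
  overlap : G → G → ℕ
  len_inv : ∀ g, len g⁻¹ = len g
  len_eq_zero : ∀ g, len g = 0 ↔ g = 1
  len_add_overlap : ∀ g h, len (g⁻¹ * h) + 2 * overlap g h = len g + len h
  min_overlap_le : ∀ g h k, min (overlap g h) (overlap h k) ≤ overlap g k
  exists_prefix : ∀ g n, n ≤ len g → ∃ p, len p = n ∧ len p + len (p⁻¹ * g) = len g
  eq_one_of_mul_self : ∀ g : G, g * g = 1 → g = 1

/-! ### Tree metrics: prefixes and Nielsen reduced families. -/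

namespace TreeLength

variable {G : Type*} [Group G] (T : TreeLength G)

lemma overlap_comm (g h : G) : T.overlap g h = T.overlap h g := by
  have h1 := T.len_add_overlap g h
  have h2 := T.len_add_overlap h g
  have h3 := T.len_inv (g⁻¹ * h)
  simp only [mul_inv_rev, inv_inv] at h3
  omega

lemma overlap_self (g : G) : T.overlap g g = T.len g := by
  have h1 := T.len_add_overlap g g
  have h2 := (T.len_eq_zero (g⁻¹ * g)).2 (by simp)
  omega

lemma overlap_le_left (g h : G) : T.overlap g h ≤ T.len g := by
  have := T.min_overlap_le g h g
  rw [T.overlap_comm h g, min_self, T.overlap_self] at this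
  exact this

lemma len_mul_le (g h : G) : T.len (g * h) ≤ T.len g + T.len h := by
  have h1 := T.len_add_overlap g⁻¹ h
  rw [inv_inv, T.len_inv] at h1
  omega

/-- The element `p` lies on the geodesic from `1` to `g`. -/
def IsPrefix (p g : G) : Prop := T.len p + T.len (p⁻¹ * g) = T.len g

variable {T}

lemma IsPrefix.overlap_eq {p g : G} (h : T.IsPrefix p g) : T.overlap p g = T.len p := by
  have h1 := T.len_add_overlap p g
  unfold IsPrefix at h
  omega

/-- By `0`-hyperbolicity, the geodesics from `1` to `g` and to `h` coincide up to length `overlap g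
h`. -/
lemma IsPrefix.of_le_overlap {p g h : G} (hp : T.IsPrefix p g) (hl : T.len p ≤ T.overlap g h) :
    T.IsPrefix p h := by
  have h1 := T.len_add_overlap p h
  have h2 := T.min_overlap_le p g h
  have h3 := T.overlap_le_left p h
  rw [hp.overlap_eq] at h2
  unfold IsPrefix
  omega

lemma IsPrefix.eq_of_len_eq {p q g : G} (hp : T.IsPrefix p g) (hq : T.IsPrefix q g)
    (hl : T.len p = T.len q) : p = q := by
  have h1 := T.len_add_overlap p q
  have h2 := T.min_overlap_le p g q
  rw [hp.overlap_eq, T.overlap_comm, hq.overlap_eq] at h2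
  have h3 : T.len (p⁻¹ * q) = 0 := by omega
  rw [T.len_eq_zero, inv_mul_eq_one] at h3
  exact h3

lemma IsPrefix.len_inv_mul {p g : G} (hp : T.IsPrefix p g) :
    T.len (g⁻¹ * p) + T.len p = T.len g := by
  have h1 := T.len_inv (g⁻¹ * p)
  simp only [mul_inv_rev, inv_inv] at h1
  unfold IsPrefix at hp
  omega

/-- The reversal of the final segment complementary to a prefix is a prefix of the inverse. -/
lemma IsPrefix.inv_mul {p g : G} (hp : T.IsPrefix p g) : T.IsPrefix (g⁻¹ * p) g⁻¹ := by
  have h1 := hp.len_inv_mul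
  unfold IsPrefix
  rw [show (g⁻¹ * p)⁻¹ * g⁻¹ = p⁻¹ by group, T.len_inv, T.len_inv]
  exact h1

variable (T)

/-- A nontrivial element overlaps with its inverse in less than half of its length. -/
lemma two_mul_overlap_inv_lt {g : G} (hg : g ≠ 1) : 2 * T.overlap g g⁻¹ < T.len g := by
  by_contra! hc
  obtain ⟨p, hpl, hp⟩ := T.exists_prefix g ((T.len g + 1) / 2) (by omega)
  replace hp : T.IsPrefix p g := hp
  have hp' : T.IsPrefix p g⁻¹ := hp.of_le_overlap (by omega)
  have hq := hp.inv_mul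
  have hq' := hp'.inv_mul
  have hl := hp.len_inv_mul
  have hl' := hp'.len_inv_mul
  rw [inv_inv] at hq' hl'
  rw [T.len_inv] at hl'
  -- With this, `g⁻¹ * p` and `g * p` are prefixes of `g⁻¹` of equal length, which forces `g⁻¹ = g`.
  have hq'' : T.IsPrefix (g * p) g⁻¹ := hq'.of_le_overlap (by omega)
  have := hq.eq_of_len_eq hq'' (by omega)
  refine hg (T.eq_one_of_mul_self g ?_)
  have h2 := mul_right_cancel this
  rw [inv_eq_iff_mul_eq_one] at h2
  exact h2

/-- The value of a signed letter under an assignment of its generators. -/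
def letterVal {α : Type*} (f : α → G) (s : α × Bool) : G := cond s.2 (f s.1) (f s.1)⁻¹

lemma letterVal_not {α : Type*} (f : α → G) (s : α × Bool) :
    letterVal f (s.1, !s.2) = (letterVal f s)⁻¹ := by
  rcases s with ⟨i, _ | _⟩ <;> simp [letterVal]

/-- In a Nielsen reduced family, the value of a nonempty reduced word is at least as long as that
of some letter. The second conjunct says that the value starts with more of the first letter than
this letter has in common with any other one. -/
lemma exists_len_letterVal_le {α : Type*} (f : α → G)
    (hhalf : ∀ s t, s ≠ t → 2 * T.overlap (letterVal f s) (letterVal f t) ≤ T.len (letterVal f s))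
    (hred : ∀ v s t, t ≠ v → s ≠ (v.1, !v.2) →
      T.overlap (letterVal f v) (letterVal f t) + T.overlap (letterVal f v)⁻¹ (letterVal f s) <
        T.len (letterVal f v))
    (L : List (α × Bool)) : ∀ v, FreeGroup.IsReduced (v :: L) →
      (∃ s, T.len (letterVal f s) ≤ T.len (((v :: L).map (letterVal f)).prod)) ∧
      ∀ t, t ≠ v → T.overlap (letterVal f v) (letterVal f t) <
        T.overlap (((v :: L).map (letterVal f)).prod) (letterVal f v) := by
  induction L with
  | nil =>
    intro v _
    simp only [List.map_cons, List.map_nil, List.prod_cons, List.prod_nil, mul_one]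
    refine ⟨⟨v, le_rfl⟩, fun t ht => ?_⟩
    have := hred v v t ht (by rcases v with ⟨i, _ | _⟩ <;> simp)
    rw [T.overlap_self]
    omega
  | cons w L ih =>
    intro v hv
    rw [FreeGroup.isReduced_cons_cons] at hv
    obtain ⟨⟨s, hs⟩, hw⟩ := ih w hv.2
    rw [List.map_cons, List.prod_cons]
    generalize ((w :: L).map (letterVal f)).prod = g at *
    have hne : (v.1, !v.2) ≠ w := by
      rintro rfl
      simpa using hv.1
    have hw' := hw _ hne
    have hh := hhalf _ _ hne
    rw [letterVal_not] at hw' hh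
    -- By induction `g` follows `w` strictly beyond the point where `w` leaves `v⁻¹`. So `v` cancels
    -- no more against `g` than against `w`, which is at most half of `v`.
    have e1 := T.min_overlap_le (letterVal f w) g (letterVal f v)⁻¹
    have e2 := T.len_add_overlap (letterVal f v)⁻¹ g
    have e3 := T.len_add_overlap (letterVal f v * g) (letterVal f v)
    rw [show (letterVal f v * g)⁻¹ * letterVal f v = g⁻¹ by group, T.len_inv] at e3
    rw [inv_inv, T.len_inv] at e2
    rw [T.len_inv] at hh
    rw [T.overlap_comm _ g] at e1
    rw [T.overlap_comm _ g] at e2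
    rw [T.overlap_comm _ (letterVal f w)] at hh
    refine ⟨⟨s, by omega⟩, fun t ht => ?_⟩
    -- The part of `v` surviving at the front has length `len v` minus this cancellation.
    have := hred v w t ht hne.symm
    rw [T.overlap_comm _ (letterVal f w)] at this
    omega

end TreeLength

/-! ### Generating pairs and connected components. -/

section Graph

variable {G : Type*} [Group G]

/-- The elements `a` and `b` generate the group. -/
def Generates (a b : G) : Prop := Subgroup.closure {a, b} = ⊤

lemma Generates.symm {a b : G} (h : Generates a b) : Generates b a := by
  rw [Generates, Set.pair_comm]; exact h

lemma Generates.of_mem {a b c d : G} (h : Generates a b)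
    (ha : a ∈ Subgroup.closure {c, d}) (hb : b ∈ Subgroup.closure {c, d}) : Generates c d := by
  rw [Generates, eq_top_iff, ← h, Subgroup.closure_le]
  rintro x (rfl | rfl)
  · exact ha
  · exact hb

lemma Generates.mul_left {a b : G} (h : Generates a b) : Generates (b * a) b := by
  have h1 : b * a ∈ Subgroup.closure {b * a, b} := Subgroup.subset_closure (by simp)
  have h2 : b ∈ Subgroup.closure {b * a, b} := Subgroup.subset_closure (by simp)
  exact h.of_mem (by simpa using mul_mem (inv_mem h2) h1) h2

lemma Generates.inv_left {a b : G} (h : Generates a b) : Generates a⁻¹ b := by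
  have h1 : a⁻¹ ∈ Subgroup.closure {a⁻¹, b} := Subgroup.subset_closure (by simp)
  exact h.of_mem (by simpa using inv_mem h1) (Subgroup.subset_closure (by simp))

lemma Generates.inv_right {a b : G} (h : Generates a b) : Generates a b⁻¹ :=
  h.symm.inv_left.symm

lemma Generates.mul_right {a b : G} (h : Generates a b) : Generates (a * b) b := by
  simpa using h.inv_left.inv_right.mul_left.inv_left.inv_right

lemma Generates.conj {a b : G} (h : Generates a b) (g : G) :
    Generates (g * a * g⁻¹) (g * b * g⁻¹) := by
  have := congrArg (Subgroup.map (MulAut.conj g).toMonoidHom) h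
  rw [MonoidHom.map_closure, Set.image_pair, ← MonoidHom.range_eq_map,
    MonoidHom.range_eq_top.2 (MulAut.conj g).surjective] at this
  exact this

variable (hG : ¬ IsCyclic G)
include hG

lemma Generates.ne {a b : G} (h : Generates a b) : a ≠ b := by
  rintro rfl
  rw [Generates, Set.pair_eq_singleton, ← Subgroup.zpowers_eq_closure] at h
  exact hG ⟨a, fun x => Subgroup.mem_zpowers_iff.1 (h ▸ Subgroup.mem_top x)⟩

lemma Generates.ne_one {a b : G} (h : Generates a b) : b ≠ 1 := by
  rintro rfl
  have := h.symm.inv_left.symm.mul_left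
  rw [inv_one, one_mul] at this
  refine Generates.ne hG (this.of_mem (c := a) (d := a) ?_ (one_mem _)) rfl
  exact Subgroup.subset_closure (by simp)

lemma Generates.adj {a b : G} (h : Generates a b) : (generatingGraph G).Adj a b :=
  ⟨h.ne hG, h⟩

lemma Generates.reachable {a b c : G} (h : Generates a b) (h' : Generates c b) :
    (generatingGraph G).Reachable a c :=
  (h.adj hG).reachable.trans (h'.adj hG).symm.reachable

omit hG in
lemma reachable_conj {a b : G} (h : (generatingGraph G).Reachable a b) (g : G) :
    (generatingGraph G).Reachable (g * a * g⁻¹) (g * b * g⁻¹) := by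
  refine h.map (⟨fun x => g * x * g⁻¹, fun {x y} hxy => ⟨fun e => hxy.1 (by simpa using e), ?_⟩⟩ :
    generatingGraph G →g generatingGraph G)
  exact Generates.conj hxy.2 g

/-- Conjugation stays in the connected component of a non-isolated vertex. -/
lemma Generates.reachable_conj {a b : G} (h : Generates a b) (g : G) :
    (generatingGraph G).Reachable a (g * a * g⁻¹) := by
  have hg : g ∈ Subgroup.closure {a, b} := by rw [show Subgroup.closure {a, b} = ⊤ from h]; trivial
  induction hg using Subgroup.closure_induction with
  | mem x hx =>
    rcases hx with rfl | rfl
    · simp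
    -- Conjugation by `b` fixes `b`, so `a` and its conjugate share the partner `b`.
    · exact h.reachable hG (by simpa using h.conj x)
  | one => simp
  | mul x y _ _ hx hy =>
    have := GeneratingGraph.reachable_conj hy x
    refine hx.trans ?_
    convert this using 1
    group
  | inv x _ hx =>
    have := GeneratingGraph.reachable_conj hx x⁻¹
    rw [show x⁻¹ * (x * a * x⁻¹) * x⁻¹⁻¹ = a by group] at this
    exact this.symm

/-! ### Cancellation in minimal pairs. -/

omit hG

/-- A generating pair of least total length among those that contain a vertex of the same
connected component. -/
def IsMinimalPair (T : TreeLength G) (a b : G) : Prop :=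
  Generates a b ∧ ∀ c d, Generates c d → (generatingGraph G).Reachable a c →
    T.len a + T.len b ≤ T.len c + T.len d

namespace IsMinimalPair

variable {T : TreeLength G} {a b : G}

include hG in
lemma symm (h : IsMinimalPair T a b) : IsMinimalPair T b a :=
  ⟨h.1.symm, fun c d hcd hr => by
    rw [add_comm]; exact h.2 c d hcd ((h.1.adj hG).reachable.trans hr)⟩

include hG in
lemma inv_left (h : IsMinimalPair T a b) : IsMinimalPair T a⁻¹ b :=
  ⟨h.1.inv_left, fun c d hcd hr => by
    rw [T.len_inv]; exact h.2 c d hcd ((h.1.reachable hG h.1.inv_left).trans hr)⟩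

include hG in
lemma inv_right (h : IsMinimalPair T a b) : IsMinimalPair T a b⁻¹ :=
  ((h.symm hG).inv_left hG).symm hG

-- Otherwise replacing `b` by `a⁻¹ * b` would shorten the pair.
include hG in
lemma two_mul_overlap_le (h : IsMinimalPair T a b) : 2 * T.overlap a b ≤ T.len a := by
  have h1 := T.len_add_overlap a b
  have h2 : Generates (a⁻¹ * b) a := by simpa using h.1.symm.inv_right.mul_left.inv_right
  have := (h.symm hG).2 _ _ h2 (h.1.symm.reachable hG h2)
  omega

-- Otherwise both overlaps are exactly half of `a`, so `a` and `a⁻¹` both follow `b` that far and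
-- share half their length.
include hG in
lemma overlap_add_overlap_lt (h : IsMinimalPair T a b) :
    T.overlap a b + T.overlap a⁻¹ b < T.len a := by
  by_contra! hc
  have h1 := h.two_mul_overlap_le hG
  have h2 := (h.inv_left hG).two_mul_overlap_le hG
  have h3 := T.two_mul_overlap_inv_lt (h.1.symm.ne_one hG)
  have h4 := T.min_overlap_le a b a⁻¹
  rw [T.overlap_comm b] at h4
  rw [T.len_inv] at h2
  omega

/-- If `a = p * q⁻¹` with both halves cancelling in `b = p * c * q⁻¹`, then `(b * a⁻¹, a)` is
conjugate to the shorter pair `(c, q⁻¹ * p)`. -/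
lemma overlap_add_overlap_inv_lt (hG : ¬ IsCyclic G) (h : IsMinimalPair T a b) :
    T.overlap a b + T.overlap a⁻¹ b⁻¹ < T.len a := by
  by_contra! hc
  have h1 := h.two_mul_overlap_le hG
  have h2 := ((h.inv_left hG).inv_right hG).two_mul_overlap_le hG
  have h3 := (h.symm hG).two_mul_overlap_le hG
  have hpos : T.len a ≠ 0 := fun h0 => h.1.symm.ne_one hG ((T.len_eq_zero a).1 h0)
  rw [T.overlap_comm] at h3
  rw [T.len_inv] at h2
  -- Both overlaps must be exactly half of `a`; here `q = a⁻¹ * p`.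
  obtain ⟨p, hpl, hp⟩ := T.exists_prefix a (T.overlap a b) (by omega)
  replace hp : T.IsPrefix p a := hp
  have hpb : T.IsPrefix p b := hp.of_le_overlap hpl.le
  have hl := hp.len_inv_mul
  have hqb : T.IsPrefix (a⁻¹ * p) b⁻¹ := hp.inv_mul.of_le_overlap (by omega)
  have hbq := hqb.inv_mul
  have hbl := hqb.len_inv_mul
  rw [inv_inv] at hbq hbl
  rw [T.len_inv] at hbl
  -- Since `len a ≤ len b`, the prefixes `p` and `b * q` of `b` are nested, so `c` has length at
  -- most `len b - len a`, while `q⁻¹ * p` has length at most `len a`.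
  have e1 := T.min_overlap_le p b (b * (a⁻¹ * p))
  rw [hpb.overlap_eq, T.overlap_comm b, hbq.overlap_eq] at e1
  have e2 := T.len_add_overlap p (b * (a⁻¹ * p))
  have e4 := T.len_mul_le (a⁻¹ * p)⁻¹ p
  rw [T.len_inv] at e4
  have g1 : Generates (b * a⁻¹) a := by simpa using h.1.symm.inv_right.mul_right.inv_right
  have := (h.symm hG).2 _ _ (g1.conj p⁻¹)
    ((h.1.symm.reachable hG g1).trans (g1.reachable_conj hG p⁻¹))
  rw [show p⁻¹ * (b * a⁻¹) * p⁻¹⁻¹ = p⁻¹ * (b * (a⁻¹ * p)) by group,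
    show p⁻¹ * a * p⁻¹⁻¹ = (a⁻¹ * p)⁻¹ * p by group] at this
  omega

end IsMinimalPair

end Graph


/-! ### Word length in a free group as a tree metric. -/

section Words

variable {β : Type*} [DecidableEq β]

/-- The length of the longest common prefix of two lists. -/
def commonPrefixLength : List β → List β → ℕ
  | x :: L, y :: M => if x = y then commonPrefixLength L M + 1 else 0
  | _, _ => 0

lemma min_commonPrefixLength_le (L M N : List β) :
    min (commonPrefixLength L M) (commonPrefixLength M N) ≤ commonPrefixLength L N := by
  induction L generalizing M N with
  | nil => simp [commonPrefixLength]
  | cons x L ih =>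
    rcases M with _ | ⟨y, M⟩
    · simp [commonPrefixLength]
    rcases N with _ | ⟨z, N⟩
    · simp [commonPrefixLength]
    have := ih M N
    simp only [commonPrefixLength]
    split_ifs <;> simp_all

variable {α : Type*} [DecidableEq α]

lemma norm_mk_of_isReduced {L : List (α × Bool)} (h : FreeGroup.IsReduced L) :
    (FreeGroup.mk L).norm = L.length := by
  rw [FreeGroup.norm, FreeGroup.toWord_mk, h.reduce_eq]

lemma isReduced_invRev {L : List (α × Bool)} (h : FreeGroup.IsReduced L) :
    FreeGroup.IsReduced (FreeGroup.invRev L) := by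
  rw [FreeGroup.isReduced_iff_reduce_eq, FreeGroup.reduce_invRev, h.reduce_eq]

/-- Common first letters cancel; once the first letters differ, the inverse word of `L` followed by
`M` is already reduced. -/
lemma norm_inv_mul_add_commonPrefixLength {L M : List (α × Bool)} (hL : FreeGroup.IsReduced L)
    (hM : FreeGroup.IsReduced M) :
    ((FreeGroup.mk L)⁻¹ * FreeGroup.mk M).norm + 2 * commonPrefixLength L M =
      L.length + M.length := by
  induction L generalizing M with
  | nil =>
    simp [commonPrefixLength, ← FreeGroup.one_eq_mk, norm_mk_of_isReduced hM]
  | cons x L ih =>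
    rcases M with _ | ⟨y, M⟩
    · simp [commonPrefixLength, ← FreeGroup.one_eq_mk, FreeGroup.norm_inv_eq,
        norm_mk_of_isReduced hL, -FreeGroup.inv_mk]
    by_cases hxy : x = y
    · subst hxy
      have := ih (hL.infix (List.suffix_cons x L).isInfix) (hM.infix (List.suffix_cons x M).isInfix)
      rw [← List.singleton_append, ← List.singleton_append (l := M), ← FreeGroup.mul_mk,
        ← FreeGroup.mul_mk, mul_inv_rev, mul_assoc, inv_mul_cancel_left]
      simp only [List.singleton_append, commonPrefixLength, if_true, List.length_cons]
      omega
    · have h1 : FreeGroup.IsReduced (FreeGroup.invRev (x :: L) ++ y :: M) := by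
        have h2 := isReduced_invRev hL
        refine List.IsChain.append h2 hM ?_
        rcases x with ⟨i, u⟩
        rcases y with ⟨j, v⟩
        simp only [FreeGroup.invRev, List.map_cons, List.reverse_cons, List.getLast?_append,
          List.getLast?_singleton, List.head?_cons, Option.mem_def]
        rintro _ h3 _ h4
        simp only [Option.some_or, Option.some.injEq] at h3 h4
        subst h3 h4
        rintro h5
        simp only at h5
        subst h5
        cases u <;> cases v <;> simp_all
      rw [FreeGroup.inv_mk, FreeGroup.mul_mk, norm_mk_of_isReduced h1]
      simp [commonPrefixLength, hxy]

/-- The word length of a free group with respect to a basis. -/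
def basisLength {F : Type*} [Group F] (basis : FreeGroupBasis α F) : TreeLength F where
  len g := (basis.repr g).norm
  overlap g h := commonPrefixLength (basis.repr g).toWord (basis.repr h).toWord
  len_inv g := by simp [FreeGroup.norm_inv_eq]
  len_eq_zero g := by simp
  len_add_overlap g h := by
    have := norm_inv_mul_add_commonPrefixLength (FreeGroup.isReduced_toWord (x := basis.repr g))
      (FreeGroup.isReduced_toWord (x := basis.repr h))
    rw [FreeGroup.mk_toWord, FreeGroup.mk_toWord] at this
    rw [map_mul, map_inv, this]
    rfl
  min_overlap_le g h k := min_commonPrefixLength_le _ _ _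
  exists_prefix g n hn := by
    have hr := FreeGroup.isReduced_toWord (x := basis.repr g)
    have hm := FreeGroup.mk_toWord (x := basis.repr g)
    have hl : (basis.repr g).norm = (basis.repr g).toWord.length := rfl
    rw [hl] at hn ⊢
    generalize (basis.repr g).toWord = L at *
    have h1 : (FreeGroup.mk (L.take n)).norm = n := by
      rw [norm_mk_of_isReduced (hr.infix (List.take_prefix n L).isInfix), List.length_take]
      omega
    refine ⟨basis.repr.symm (FreeGroup.mk (L.take n)), by simpa using h1, ?_⟩
    have h2 : (FreeGroup.mk (L.take n))⁻¹ * FreeGroup.mk L = FreeGroup.mk (L.drop n) := by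
      rw [inv_mul_eq_iff_eq_mul, FreeGroup.mul_mk, List.take_append_drop]
    rw [map_mul, map_inv, MulEquiv.apply_symm_apply, ← hm, h2, h1,
      norm_mk_of_isReduced (hr.infix (List.drop_suffix n L).isInfix), List.length_drop]
    omega
  eq_one_of_mul_self g hg := by
    have h1 : basis.repr g ^ 2 = 1 := by rw [← map_pow, pow_two, hg, map_one]
    have h2 := (pow_eq_one_iff_left two_ne_zero).1 h1
    simpa using h2

lemma exists_eq_or_eq_inv_of_len_eq_one {F : Type*} [Group F] (basis : FreeGroupBasis α F) {g : F}
    (hg : (basisLength basis).len g = 1) : ∃ i, g = basis i ∨ g = (basis i)⁻¹ := by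
  have hl : (basis.repr g).toWord.length = 1 := hg
  rw [List.length_eq_one_iff] at hl
  obtain ⟨⟨i, e⟩, hi⟩ := hl
  have hm := FreeGroup.mk_toWord (x := basis.repr g)
  rw [hi] at hm
  refine ⟨i, ?_⟩
  cases e
  · right
    apply basis.repr.injective
    rw [map_inv, basis.repr_apply_coe, ← hm]
    rfl
  · left
    apply basis.repr.injective
    rw [basis.repr_apply_coe, ← hm]
    rfl

end Words

/-! ### Reduction to the basis in rank two. -/

section RankTwo

variable {F : Type*} [Group F] (basis : FreeGroupBasis (Fin 2) F)

include basis in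
lemma not_isCyclic_of_basis : ¬ IsCyclic F := by
  intro h
  have h1 : basis 0 * basis 1 = basis 1 * basis 0 :=
    (IsCyclic.isMulCommutative (α := F)).is_comm.comm _ _
  have h2 := congrArg (fun g => (basis.repr g).toWord) h1
  simp only [map_mul, basis.repr_apply_coe] at h2
  revert h2
  decide

lemma generates_basis : Generates (basis 0) (basis 1) := by
  rw [Generates, eq_top_iff]
  intro g _
  obtain ⟨w, rfl⟩ := basis.repr.symm.surjective g
  induction w using FreeGroup.induction_on with
  | C1 => simp
  | of i =>
    refine Subgroup.subset_closure ?_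
    change basis i ∈ _
    fin_cases i <;> simp
  | inv_of i hi => rw [map_inv]; exact inv_mem (hi trivial)
  | mul x y hx hy => rw [map_mul]; exact mul_mem (hx trivial) (hy trivial)

lemma reachable_basis (i : Fin 2) :
    (generatingGraph F).Reachable (basis i) (basis 0) ∧
      (generatingGraph F).Reachable (basis i)⁻¹ (basis 0) := by
  have hG := not_isCyclic_of_basis basis
  have h := generates_basis basis
  fin_cases i
  · exact ⟨.rfl, h.inv_left.reachable hG h⟩
  · exact ⟨(h.symm.adj hG).reachable, (h.inv_right.symm.adj hG).reachable⟩

/-- A minimal pair contains a basis element or its inverse. -/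
lemma IsMinimalPair.exists_letterVal_len_eq_one {a b : F}
    (h : IsMinimalPair (basisLength basis) a b) :
    ∃ s, (basisLength basis).len (TreeLength.letterVal ![a, b] s) = 1 := by
  have hG := not_isCyclic_of_basis basis
  have hpair : ∀ s t : Fin 2 × Bool, s.1 ≠ t.1 → IsMinimalPair (basisLength basis)
      (TreeLength.letterVal ![a, b] s) (TreeLength.letterVal ![a, b] t) := by
    rintro ⟨i, u⟩ ⟨j, v⟩ hij
    have key : IsMinimalPair (basisLength basis) (![a, b] i) (![a, b] j) := by
      fin_cases i <;> fin_cases j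
      · exact absurd rfl hij
      · exact h
      · exact h.symm hG
      · exact absurd rfl hij
    cases u <;> cases v
    · exact (key.inv_left hG).inv_right hG
    · exact key.inv_left hG
    · exact key.inv_right hG
    · exact key
  have hcases : ∀ s t : Fin 2 × Bool, s.1 ≠ t.1 ∨ t = s ∨ t = (s.1, !s.2) := by decide
  have hother : ∀ v s t : Fin 2 × Bool, v.1 ≠ s.1 → v.1 ≠ t.1 → s = t ∨ s = (t.1, !t.2) := by
    decide
  have hother' : ∀ v : Fin 2 × Bool, ∃ s : Fin 2 × Bool, v.1 ≠ s.1 := by decide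
  have hne : ∀ s, TreeLength.letterVal ![a, b] s ≠ 1 := fun s => by
    obtain ⟨t, ht⟩ := hother' s
    exact (hpair s t ht).1.symm.ne_one hG
  have hhalf : ∀ s t, s ≠ t → 2 * (basisLength basis).overlap (TreeLength.letterVal ![a, b] s)
      (TreeLength.letterVal ![a, b] t) ≤
        (basisLength basis).len (TreeLength.letterVal ![a, b] s) := by
    intro s t hst
    rcases hcases s t with h1 | rfl | rfl
    · exact (hpair s t h1).two_mul_overlap_le hG
    · exact absurd rfl hst
    · rw [TreeLength.letterVal_not]
      exact ((basisLength basis).two_mul_overlap_inv_lt (hne s)).le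
  have hred : ∀ v s t, t ≠ v → s ≠ (v.1, !v.2) →
      (basisLength basis).overlap (TreeLength.letterVal ![a, b] v)
        (TreeLength.letterVal ![a, b] t) +
      (basisLength basis).overlap (TreeLength.letterVal ![a, b] v)⁻¹
        (TreeLength.letterVal ![a, b] s) <
        (basisLength basis).len (TreeLength.letterVal ![a, b] v) := by
    intro v s t ht hs
    have h1 := hhalf v t ht.symm
    have h2 := hhalf _ s hs.symm
    have h3 := (basisLength basis).two_mul_overlap_inv_lt (hne v)
    rw [TreeLength.letterVal_not, TreeLength.len_inv] at h2
    -- If `s` and `t` both avoid the generator of `v`, they are equal or inverse, and the minimal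
    -- pair bounds apply. Otherwise one overlap is between `v` and `v⁻¹`, hence strictly below half.
    rcases hcases v t with hvt | rfl | rfl
    · rcases hcases v s with hvs | rfl | rfl
      · rcases hother v s t hvs hvt with rfl | rfl
        · exact (hpair v s hvs).overlap_add_overlap_lt hG
        · rw [TreeLength.letterVal_not]
          exact (hpair v t hvt).overlap_add_overlap_inv_lt hG
      · rw [TreeLength.overlap_comm] at h3
        omega
      · exact absurd rfl hs
    · exact absurd rfl ht
    · rw [TreeLength.letterVal_not]
      omega
  have hsurj : Function.Surjective (FreeGroup.lift ![a, b]) := by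
    rw [← MonoidHom.range_eq_top, FreeGroup.range_lift_eq_closure, Matrix.range_cons,
      Matrix.range_cons, Matrix.range_empty, Set.union_empty, Set.singleton_union]
    exact h.1
  obtain ⟨w, hw⟩ := hsurj (basis 0)
  have hlen : (basisLength basis).len (basis 0) = 1 := by
    change (basis.repr (basis 0)).norm = 1
    rw [basis.repr_apply_coe, FreeGroup.norm_of]
  have hred' := FreeGroup.isReduced_toWord (x := w)
  rw [← FreeGroup.mk_toWord (x := w), FreeGroup.lift_mk] at hw
  rcases hL : w.toWord with _ | ⟨v, L⟩
  · rw [hL] at hw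
    exact absurd hw.symm ((generates_basis basis).symm.ne_one hG)
  · rw [hL] at hw hred'
    obtain ⟨⟨s, hs⟩, -⟩ := (basisLength basis).exists_len_letterVal_le ![a, b] hhalf hred L v hred'
    have h1 : ((v :: L).map (TreeLength.letterVal ![a, b])).prod = basis 0 := hw
    rw [h1, hlen] at hs
    have h2 := mt ((basisLength basis).len_eq_zero _).1 (hne s)
    exact ⟨s, by omega⟩

/-- Every non-isolated vertex is connected to the first basis element. -/
lemma Generates.reachable_basis {a b : F} (h : Generates a b) :
    (generatingGraph F).Reachable a (basis 0) := by
  have hG := not_isCyclic_of_basis basis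
  induction hn : (basisLength basis).len a + (basisLength basis).len b using Nat.strong_induction_on
    generalizing a b with
  | _ n ih =>
  by_cases hmin : IsMinimalPair (basisLength basis) a b
  · obtain ⟨s, hs⟩ := hmin.exists_letterVal_len_eq_one
    have h1 : (generatingGraph F).Reachable a (TreeLength.letterVal ![a, b] s) := by
      rcases s with ⟨i, _ | _⟩ <;> fin_cases i
      · exact h.reachable hG h.inv_left
      · exact (h.inv_right.adj hG).reachable
      · exact .rfl
      · exact (h.adj hG).reachable
    obtain ⟨i, hi | hi⟩ := exists_eq_or_eq_inv_of_len_eq_one basis hs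
    · exact h1.trans (hi ▸ (GeneratingGraph.reachable_basis basis i).1)
    · exact h1.trans (hi ▸ (GeneratingGraph.reachable_basis basis i).2)
  -- Failure of minimality supplies a shorter generating pair in the same component.
  · simp only [IsMinimalPair, h, true_and, not_forall, not_le] at hmin
    obtain ⟨c, d, hcd, hr, hlt⟩ := hmin
    exact hr.trans (ih _ (hn ▸ hlt) hcd rfl)

end RankTwo

/-- A path between non-isolated vertices only passes through non-isolated vertices. -/
lemma reachable_induce_support {V : Type*} (Γ : SimpleGraph V) {u v : V} (p : Γ.Walk u v)
    (hu : u ∈ Γ.support) (hv : v ∈ Γ.support) :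
    (Γ.induce Γ.support).Reachable ⟨u, hu⟩ ⟨v, hv⟩ := by
  induction p with
  | nil => exact .rfl
  | @cons u w v huw p ih =>
    have hw : w ∈ Γ.support := ⟨u, huw.symm⟩
    have hadj : (Γ.induce Γ.support).Adj ⟨u, hu⟩ ⟨w, hw⟩ := huw
    exact hadj.reachable.trans (ih hw hv)

end GeneratingGraph

open GeneratingGraph in
theorem theorem11 {F : Type*} [Group F] (basis : FreeGroupBasis (Fin 2) F) :
    (reducedGeneratingGraph F).Connected := by
  have hbase := ((generates_basis basis).adj (not_isCyclic_of_basis basis))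
  have : Nonempty (generatingGraph F).support := ⟨⟨basis 0, _, hbase⟩⟩
  refine ⟨?_⟩
  rintro ⟨u, u', hu⟩ ⟨v, v', hv⟩
  obtain ⟨p⟩ := (Generates.reachable_basis basis hu.2).trans
    (Generates.reachable_basis basis hv.2).symm
  exact reachable_induce_support _ p _ _
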